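/- For real $t$ let $I_\nu(t)=\sum_{k\ge 0}\frac{(t/2)^{2k+\nu}}{k!\,(k+\nu)!}$ be the modified Bessel function and let $\phi_n(z)=\phi_n(z;t)$, $n\ge 0$, be the polynomials of degree $n$ with leading coefficient $\kappa_n=\kappa_n(t)>0$ that are orthonormal on the unit circle with respect to the weight $w(z)=\frac{1}{2\pi I_0(t)}\exp\big(\tfrac t2(z+z^{-1})\big)$, that is, $$\int_{|\zeta|=1}\phi_m(\zeta)\overline{\phi_n(\zeta)}\,w(\zeta)\,\frac{d\zeta}{i\zeta}=\delta_{m,n}.$$ Let $r_n(t)=\phi_n(0)/\kappa_n$ be the reflection coefficients. Then for every $n\ge 1$ the following hold. (a) For every real $t\neq 0$, $r_n(t)\neq\pm1$, $r_n$ is twice differentiable at $t$, and $$\frac{d^2r_n}{dt^2}=\frac12\left(\frac1{r_n+1}+\frac1{r_n-1}\right)\left(\frac{dr_n}{dt}\right)^2-\frac1t\frac{dr_n}{dt}-r_n(1-r_n^2)+\frac{n^2}{t^2}\,\frac{r_n}{1-r_n^2}.$$ (b) As $t\to0$, $$r_n(t)=\frac{(-t/2)^n}{n!}\left\{1-\frac1{n+1}\,\frac{t^2}{4}+O(t^4)\right\}.$$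 (c) For real $t\ne 0$ the relation $r_n(t)=\frac{z_n(t)+1}{z_n(t)-1}$ with $z_n(t)\neq1$ can be solved for $z_n(t)$, and the resulting function $z_n$ avoids the values $0$ and $1$, is twice differentiable and satisfies, for all real $t\neq0$, the fifth Painlevé equation $$\frac{d^2z}{dt^2}=\left(\frac1{2z}+\frac1{z-1}\right)\left(\frac{dz}{dt}\right)^2-\frac1t\frac{dz}{dt}+\frac{(z-1)^2}{t^2}\left(\alpha z+\frac{\beta}{z}\right)+\frac{\gamma z}{t}+\frac{\delta z(z+1)}{z-1}$$ with $\alpha=-\beta=\frac{n^2}{8}$, $\gamma=0$, $\delta=-2$. -/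

import Mathlib

open Polynomial Filter Topology Asymptotics
open scoped ComplexConjugate

/-- The modified Bessel function of the first kind `I_ν(t)` of integer order `ν ≥ 0`, defined by
its (everywhere convergent) power series. -/
noncomputable def besselI (ν : ℕ) (t : ℝ) : ℝ :=
  ∑' k : ℕ, (t / 2) ^ (2 * k + ν) / ((k.factorial : ℝ) * ((k + ν).factorial : ℝ))

/-- The modified Bessel weight `w(z) = exp(t (z + 1/z) / 2) / (2 π I_0(t))`. -/
noncomputable def besselWeight (t : ℝ) (z : ℂ) : ℂ :=
  Complex.exp ((t : ℂ) * (z + z⁻¹) / 2) / (2 * (Real.pi : ℂ) * (besselI 0 t : ℂ))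

/-- `φ 0, φ 1, φ 2, …` is the system of orthonormal polynomials on the unit circle for the
weight `w`: `φ n` has degree `n` and positive leading coefficient, and
`∫_{|ζ| = 1} φ_m(ζ) conj(φ_n(ζ)) w(ζ) dζ / (i ζ) = δ_{m,n}`. -/
structure IsOPUC (w : ℂ → ℂ) (φ : ℕ → ℂ[X]) : Prop where
  natDegree_eq : ∀ n, (φ n).natDegree = n
  leadingCoeff_pos : ∀ n, ∃ κ : ℝ, 0 < κ ∧ (φ n).leadingCoeff = (κ : ℂ)
  orthonormal : ∀ m n,
    (∮ ζ in C(0, 1), (φ m).eval ζ * conj ((φ n).eval ζ) * w ζ / (Complex.I * ζ))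
      = if m = n then 1 else 0

theorem circle_polynomial_nonzero {p : ℂ[X]} (hp : p ≠ 0) :
    ∃ θ ∈ Set.Icc 0 (2 * Real.pi), p.eval (circleMap 0 1 θ) ≠ 0 := by
  by_contra! h
  apply hp
  refine Polynomial.eq_zero_of_infinite_isRoot p ?_
  have hinj : Set.InjOn (circleMap 0 1) (Set.Ioc 0 (2 * Real.pi)) := by
    rw [← Set.uIoc_of_le (by positivity : (0 : ℝ) ≤ 2 * Real.pi)]
    refine injOn_circleMap_of_abs_sub_le one_ne_zero ?_
    simp [abs_of_pos Real.pi_pos]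
  have hinf : (circleMap 0 1 '' Set.Ioc 0 (2 * Real.pi)).Infinite :=
    (Set.Ioc_infinite (by positivity)).image hinj
  refine hinf.mono ?_
  rintro _ ⟨θ, hθ, rfl⟩
  exact h θ ⟨hθ.1.le, hθ.2⟩

/-- The inner product of `L²` of the unit circle on polynomials, for a positive continuous
density `g` of the angle. -/
@[reducible]
noncomputable def circleCore (g : ℝ → ℝ) (hg : Continuous g) (hpos : ∀ θ, 0 < g θ) :
    InnerProductSpace.Core ℂ ℂ[X] where
  inner p q := ∫ θ in (0 : ℝ)..2 * Real.pi,
    conj (p.eval (circleMap 0 1 θ)) * q.eval (circleMap 0 1 θ) * (g θ : ℂ)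
  conj_inner_symm p q := by
    rw [← intervalIntegral.intervalIntegral_conj]
    congr 1; ext θ
    simp [mul_comm]
  re_inner_nonneg p := by
    have : (∫ θ in (0 : ℝ)..2 * Real.pi,
        conj (p.eval (circleMap 0 1 θ)) * p.eval (circleMap 0 1 θ) * (g θ : ℂ))
        = ((∫ θ in (0 : ℝ)..2 * Real.pi, ‖p.eval (circleMap 0 1 θ)‖ ^ 2 * g θ : ℝ) : ℂ) := by
      rw [← intervalIntegral.integral_ofReal]
      congr 1; ext θ
      rw [mul_comm (conj _), Complex.mul_conj, Complex.normSq_eq_norm_sq]; push_cast; rfl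
    rw [this]
    refine intervalIntegral.integral_nonneg (by positivity) fun θ _ => ?_
    have := (hpos θ).le
    positivity
  add_left p q r := by
    rw [← intervalIntegral.integral_add]
    · congr 1; ext θ
      simp; ring
    all_goals
      apply Continuous.intervalIntegrable
      fun_prop
  smul_left p q c := by
    rw [← intervalIntegral.integral_const_mul]
    congr 1; ext θ
    simp; ring
  definite p h := by
    by_contra hp
    obtain ⟨θ₀, hθ₀, hne⟩ := circle_polynomial_nonzero hp
    have : (∫ θ in (0 : ℝ)..2 * Real.pi,
        conj (p.eval (circleMap 0 1 θ)) * p.eval (circleMap 0 1 θ) * (g θ : ℂ))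
        = ((∫ θ in (0 : ℝ)..2 * Real.pi, ‖p.eval (circleMap 0 1 θ)‖ ^ 2 * g θ : ℝ) : ℂ) := by
      rw [← intervalIntegral.integral_ofReal]
      congr 1; ext θ
      rw [mul_comm (conj _), Complex.mul_conj, Complex.normSq_eq_norm_sq]; push_cast; rfl
    rw [this, Complex.ofReal_eq_zero] at h
    refine (intervalIntegral.integral_pos (by positivity) ?_ ?_ ⟨θ₀, hθ₀, ?_⟩).ne' h
    · apply Continuous.continuousOn
      fun_prop
    · intro θ _
      have := (hpos θ).le
      positivity
    · have := hpos θ₀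
      positivity

/-- Gram-Schmidt: a positive continuous weight on the unit circle has a system of orthonormal
polynomials. -/
theorem exists_isOPUC {w : ℂ → ℂ} (g : ℝ → ℝ) (hg : Continuous g) (hpos : ∀ θ, 0 < g θ)
    (hw : ∀ θ, w (circleMap 0 1 θ) = (g θ : ℂ)) : ∃ φ, IsOPUC w φ := by
  let core := circleCore g hg hpos
  let _ : NormedAddCommGroup ℂ[X] := core.toNormedAddCommGroup
  let _ : InnerProductSpace ℂ ℂ[X] := InnerProductSpace.ofCore core.toCore
  let f : ℕ → ℂ[X] := fun n => X ^ n
  have hlin : LinearIndependent ℂ f := by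
    have := (Polynomial.basisMonomials ℂ).linearIndependent
    convert this using 1
    ext1 n
    simp [f, Polynomial.X_pow_eq_monomial]
  let G := InnerProductSpace.gramSchmidt ℂ f
  have hdeg : ∀ n, (G n).degree = n ∧ (G n).Monic := by
    intro n
    induction n using Nat.strong_induction_on with
    | _ n ih =>
      have hG : G n = X ^ n - ∑ i ∈ Finset.Iio n,
          (inner ℂ (G i) (f n) / (‖G i‖ : ℂ) ^ 2) • G i :=
        eq_sub_of_add_eq (InnerProductSpace.gramSchmidt_def'' ℂ f n).symm
      have hlt : (∑ i ∈ Finset.Iio n,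
          (inner ℂ (G i) (f n) / (‖G i‖ : ℂ) ^ 2) • G i).degree < n := by
        refine (Polynomial.degree_sum_le _ _).trans_lt ?_
        refine (Finset.sup_lt_iff (WithBot.bot_lt_coe n)).2 fun i hi => ?_
        have hi' := Finset.mem_Iio.1 hi
        refine (Polynomial.degree_smul_le _ _).trans_lt ?_
        rw [(ih i hi').1]
        exact WithBot.coe_lt_coe.2 hi'
      rw [hG]
      exact ⟨by rw [Polynomial.degree_sub_eq_left_of_degree_lt] <;> simp [hlt],
        (Polynomial.monic_X_pow n).sub_of_left (by simpa using hlt)⟩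
  have hne : ∀ n, G n ≠ 0 := fun n => (hdeg n).2.ne_zero
  have hlead : ∀ n, (InnerProductSpace.gramSchmidtNormed ℂ f n).leadingCoeff
      = ((‖G n‖⁻¹ : ℝ) : ℂ) := by
    intro n
    rw [InnerProductSpace.gramSchmidtNormed, Polynomial.smul_eq_C_mul,
      Polynomial.leadingCoeff_mul]
    have := (hdeg n).2.leadingCoeff
    simp only [G] at this ⊢
    simp [this]
  refine ⟨InnerProductSpace.gramSchmidtNormed ℂ f, ?_, ?_, ?_⟩
  · intro n
    rw [InnerProductSpace.gramSchmidtNormed, Polynomial.natDegree_smul]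
    · exact Polynomial.natDegree_eq_of_degree_eq_some (hdeg n).1
    · simpa using hne n
  · intro n
    exact ⟨_, inv_pos.2 (norm_pos_iff.2 (hne n)), hlead n⟩
  · intro m n
    have h := orthonormal_iff_ite.1 (InnerProductSpace.gramSchmidtNormed_orthonormal hlin) n m
    simp only [eq_comm (a := n)] at h
    rw [← h]
    change _ = ∫ θ in (0 : ℝ)..2 * Real.pi, _
    rw [circleIntegral]
    congr 1; ext θ
    have hz : circleMap 0 1 θ ≠ 0 := circleMap_ne_center one_ne_zero
    rw [hw, deriv_circleMap, smul_eq_mul]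
    field_simp

theorem besselI_zero_pos (t : ℝ) : 0 < besselI 0 t := by
  have hnn : ∀ k : ℕ, 0 ≤ (t / 2) ^ (2 * k + 0) / ((k.factorial : ℝ) * ((k + 0).factorial : ℝ)) := by
    intro k
    rw [add_zero, pow_mul]
    positivity
  have hs : Summable fun k : ℕ => (t / 2) ^ (2 * k + 0) / ((k.factorial : ℝ) * ((k + 0).factorial : ℝ)) := by
    refine Summable.of_nonneg_of_le hnn (fun k => ?_)
      (Real.summable_pow_div_factorial ((t / 2) ^ 2))
    rw [add_zero, pow_mul, add_zero]
    have h1 : (1 : ℝ) ≤ (k.factorial : ℝ) := by exact_mod_cast Nat.factorial_pos k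
    gcongr
    nlinarith
  exact hs.tsum_pos hnn 0 (by simp)

theorem exists_besselOPUC (t : ℝ) : ∃ φ, IsOPUC (besselWeight t) φ := by
  refine exists_isOPUC (fun θ => Real.exp (t * Real.cos θ) / (2 * Real.pi * besselI 0 t)) ?_ ?_ ?_
  · fun_prop
  · intro θ
    have := besselI_zero_pos t
    positivity
  · intro θ
    have h : (t : ℂ) * (circleMap 0 1 θ + (circleMap 0 1 θ)⁻¹) / 2 = t * Complex.cos θ := by
      rw [Complex.cos, circleMap]
      simp [← Complex.exp_neg]
      ring
    simp only [besselWeight, h]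
    push_cast
    rfl

/-- The orthonormal polynomials `φ_n(z) = φ_n(z; t)` of the modified Bessel weight. (The
conditions in `IsOPUC` determine them uniquely.) -/
noncomputable def besselOPUC (t : ℝ) : ℕ → ℂ[X] :=
  Classical.choose (exists_besselOPUC t)

theorem besselOPUC_spec (t : ℝ) : IsOPUC (besselWeight t) (besselOPUC t) :=
  Classical.choose_spec (exists_besselOPUC t)

/-- The reflection coefficient `r_n(t) = φ_n(0) / κ_n`, where `κ_n` is the leading coefficient
of `φ_n`. -/
noncomputable def reflectionCoeff (n : ℕ) (t : ℝ) : ℂ :=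
  (besselOPUC t n).eval 0 / (besselOPUC t n).leadingCoeff

/-- `y` solves the fifth Painlevé equation with parameters `α, β, γ, δ` on the set `S` of real
points (which must avoid the fixed singularity `0`): there `y` is twice differentiable, avoids
the values `0` and `1`, and satisfies
`y'' = (1/(2y) + 1/(y-1)) y'² - y'/t + (y-1)²/t² (α y + β/y) + γ y/t + δ y(y+1)/(y-1)`. -/
def SolvesPainleveV (α β γ δ : ℂ) (y : ℝ → ℂ) (S : Set ℝ) : Prop :=
  ∀ t ∈ S, t ≠ 0 ∧ y t ≠ 0 ∧ y t ≠ 1 ∧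
    DifferentiableAt ℝ y t ∧ DifferentiableAt ℝ (deriv y) t ∧
    deriv (deriv y) t =
      (1 / (2 * y t) + 1 / (y t - 1)) * deriv y t ^ 2 - deriv y t / (t : ℂ)
        + (y t - 1) ^ 2 / (t : ℂ) ^ 2 * (α * y t + β / y t)
        + γ * y t / (t : ℂ) + δ * y t * (y t + 1) / (y t - 1)

/-!
The density of the weight in the angle `θ` is proportional to `exp (t cos θ)`, an even function, so
the orthonormal polynomials have real coefficients and the reflection coefficients can be studied
with the real bilinear form `besselForm t` on `ℝ[X]`, the real part of the inner product of the
circle. This form is positive definite, multiplication by `X` is an isometry for it (both facts are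
collected in `IsToeplitz`), and integration by parts gives
`B (X p') q - B p (X q') = -(t / 2) (B (X p) q - B p (X q))`.

Let `Pₙ` be the monic orthogonal polynomials, `rₙ = Pₙ(0)`, and `Pₙ*` the polynomial with reversed
coefficients. Pairing with `Pₙ*` extracts the constant term of a polynomial of degree at most `n`
(`IsMonicOrthogonal.reflect_apply`). This gives `‖Pₙ₊₁‖² = (1 - rₙ₊₁²) ‖Pₙ‖²`, hence `rₙ² < 1` for
`n ≥ 1`, and, applied to `X Pₙ' - n Pₙ` together with the integration by parts, the discrete
Painlevé II equation `-n rₙ = (t / 2) (1 - rₙ²) (rₙ₊₁ + rₙ₋₁)`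
(`IsMonicOrthogonal.discrete_painleve`).

The dependence on `t` needs no differentiation of the polynomials. The first coefficients are
`r₀ = 1` and `r₁ = -I₁ / I₀`, for which the first order system
`rₙ' = (n / t) rₙ + (1 - rₙ²) rₙ₊₁`, `rₙ₊₁' = -((n + 1) / t) rₙ₊₁ - (1 - rₙ₊₁²) rₙ`
at `n = 0` is the pair of derivative formulas of the Bessel functions. The discrete equation
expresses `rₙ₊₂` through `rₙ₊₁` and `rₙ` and carries the system from `n` to `n + 1`
(`hasDerivAt_verblunsky`). Eliminating `rₙ` from the system gives the second order equation of
`rₙ₊₁`, and a Möbius substitution turns it into Painlevé V.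

For the expansion at `0`, the second equation of the system reads
`(tⁿ⁺¹ rₙ₊₁)' = -tⁿ⁺¹ (1 - rₙ₊₁²) rₙ`. As `rₙ₊₁` is bounded, the function differentiated here
vanishes at `0`, so an expansion of the right-hand side can be integrated; no cancellation occurs,
unlike in the recurrence.
-/

/-! ### Orthogonal polynomials for a positive definite Toeplitz form -/

/-- A symmetric positive definite bilinear form on `ℝ[X]` for which multiplication by `X` is an
isometry; equivalently, its matrix in the monomial basis is a symmetric positive definite Toeplitz
matrix. -/
structure IsToeplitz (B : LinearMap.BilinForm ℝ ℝ[X]) : Prop where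
  symm : ∀ p q, B p q = B q p
  shift : ∀ p q, B (X * p) (X * q) = B p q
  pos : ∀ p, p ≠ 0 → 0 < B p p

/-- `P 0, P 1, P 2, …` are monic polynomials of degrees `0, 1, 2, …`, each orthogonal under `B` to
all lower powers of `X`. The reversed polynomial `Pₙ*` is written `(P n).reflect n`: unlike
`Polynomial.reverse`, this makes the degree `n` explicit. -/
structure IsMonicOrthogonal (B : LinearMap.BilinForm ℝ ℝ[X]) (P : ℕ → ℝ[X]) : Prop where
  monic : ∀ n, (P n).Monic
  natDegree_eq : ∀ n, (P n).natDegree = n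
  orthogonal : ∀ n j, j < n → B (P n) (X ^ j) = 0

theorem LinearMap.apply_eq_sum_coeff_mul_X_pow (f : ℝ[X] →ₗ[ℝ] ℝ) {q : ℝ[X]} {n : ℕ}
    (hq : q.natDegree ≤ n) : f q = ∑ j ∈ Finset.range (n + 1), q.coeff j * f (X ^ j) := by
  conv_lhs => rw [q.as_sum_range_C_mul_X_pow' (Nat.lt_succ_of_le hq)]
  simp [← smul_eq_C_mul]

namespace IsToeplitz

variable {B : LinearMap.BilinForm ℝ ℝ[X]}

theorem shift_pow (hB : IsToeplitz B) (k : ℕ) (p q : ℝ[X]) :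
    B (X ^ k * p) (X ^ k * q) = B p q := by
  induction k with
  | zero => simp
  | succ k ih => rw [pow_succ', mul_assoc, mul_assoc, hB.shift, ih]

theorem reflect_apply_X_pow (hB : IsToeplitz B) {n j : ℕ} (hj : j ≤ n) {p : ℝ[X]}
    (hp : p.natDegree ≤ n) :
    B (p.reflect n) (X ^ j) = B p (X ^ (n - j)) := by
  have key : ∀ i ∈ Finset.range (n + 1), B (X ^ (n - i)) (X ^ j) = B (X ^ i) (X ^ (n - j)) := by
    intro i hi
    have hi : i ≤ n := by simpa [Nat.lt_succ_iff] using hi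
    rw [← hB.shift_pow i, ← hB.shift_pow j (X ^ i), hB.symm]
    simp only [← pow_add]
    rw [Nat.add_sub_cancel' hi, Nat.add_sub_cancel' hj, add_comm]
  have h1 := (LinearMap.flip B (X ^ j)).apply_eq_sum_coeff_mul_X_pow (q := p.reflect n) (n := n)
    ((natDegree_reflect_le).trans (by simp [hp]))
  have h2 := (LinearMap.flip B (X ^ (n - j))).apply_eq_sum_coeff_mul_X_pow hp
  simp only [LinearMap.flip_apply] at h1 h2
  rw [h1, h2, ← Finset.sum_range_reflect]
  refine Finset.sum_congr rfl fun i hi => ?_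
  have hi' : i ≤ n := by simpa [Nat.lt_succ_iff] using hi
  rw [← key i hi, coeff_reflect, revAt_le (by omega)]
  congr 2
  · omega

end IsToeplitz

namespace IsMonicOrthogonal

variable {B : LinearMap.BilinForm ℝ ℝ[X]} {P : ℕ → ℝ[X]}

theorem coeff_self (hP : IsMonicOrthogonal B P) (n : ℕ) : (P n).coeff n = 1 := by
  have := (hP.monic n).coeff_natDegree
  rwa [hP.natDegree_eq] at this

theorem zero (hP : IsMonicOrthogonal B P) : P 0 = 1 :=
  (hP.monic 0).natDegree_eq_zero.1 (hP.natDegree_eq 0)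

theorem apply_of_natDegree_lt (hP : IsMonicOrthogonal B P) {n : ℕ} {q : ℝ[X]}
    (hq : q.natDegree < n) : B (P n) q = 0 := by
  rw [(B (P n)).apply_eq_sum_coeff_mul_X_pow le_rfl]
  refine Finset.sum_eq_zero fun j hj => ?_
  rw [hP.orthogonal n j (by simp at hj; omega), mul_zero]

/-- Pairing with `Pₙ` extracts the coefficient of `Xⁿ`. -/
theorem apply_of_natDegree_le (hP : IsMonicOrthogonal B P) {n : ℕ} {q : ℝ[X]}
    (hq : q.natDegree ≤ n) : B (P n) q = q.coeff n * B (P n) (P n) := by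
  have key : ∀ q : ℝ[X], q.natDegree ≤ n → B (P n) q = q.coeff n * B (P n) (X ^ n) := by
    intro q hq
    rw [(B (P n)).apply_eq_sum_coeff_mul_X_pow hq, Finset.sum_range_succ,
      Finset.sum_eq_zero, zero_add]
    intro j hj
    rw [hP.orthogonal n j (by simpa using hj), mul_zero]
  rw [key q hq, key (P n) (hP.natDegree_eq n).le, hP.coeff_self, one_mul]

theorem coeff_zero_reflect (hP : IsMonicOrthogonal B P) (n : ℕ) : ((P n).reflect n).coeff 0 = 1 := by
  rw [coeff_reflect, revAt_le (by omega), Nat.sub_zero, hP.coeff_self]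

theorem natDegree_reflect_le (hP : IsMonicOrthogonal B P) (n : ℕ) :
    ((P n).reflect n).natDegree ≤ n :=
  Polynomial.natDegree_reflect_le.trans (by simp [hP.natDegree_eq])

/-- Pairing with the reversed polynomial `Pₙ*` extracts the constant term. -/
theorem reflect_apply (hB : IsToeplitz B) (hP : IsMonicOrthogonal B P) {n : ℕ} {q : ℝ[X]}
    (hq : q.natDegree ≤ n) : B ((P n).reflect n) q = q.coeff 0 * B (P n) (P n) := by
  rw [(B ((P n).reflect n)).apply_eq_sum_coeff_mul_X_pow hq, Finset.sum_eq_single 0]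
  · rw [hB.reflect_apply_X_pow (by omega) (hP.natDegree_eq n).le, Nat.sub_zero,
      hP.apply_of_natDegree_le (natDegree_X_pow n).le, coeff_X_pow_self, one_mul]
  · intro j hj hj0
    have : j ≤ n := by simpa [Nat.lt_succ_iff] using hj
    rw [hB.reflect_apply_X_pow this (hP.natDegree_eq n).le,
      hP.orthogonal n _ (by omega), mul_zero]
  · simp

theorem natDegree_succ_sub_le (hP : IsMonicOrthogonal B P) (n : ℕ) :
    (P (n + 1) - X * P n).natDegree ≤ n := by
  rw [natDegree_le_iff_coeff_eq_zero]
  intro N hN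
  obtain ⟨N, rfl⟩ : ∃ m, N = m + 1 := ⟨N - 1, by omega⟩
  rw [coeff_sub, coeff_X_mul]
  rcases eq_or_lt_of_le (show n ≤ N by omega) with rfl | h
  · rw [hP.coeff_self, hP.coeff_self, sub_self]
  · rw [coeff_eq_zero_of_natDegree_lt (by rw [hP.natDegree_eq]; omega),
      coeff_eq_zero_of_natDegree_lt (by rw [hP.natDegree_eq]; omega), sub_self]

/-- The weak form of the Szegő recurrence `Pₙ₊₁ = X Pₙ + Pₙ₊₁(0) Pₙ*`: both sides have the same
product with every polynomial of degree at most `n`. -/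
theorem X_mul_apply (hB : IsToeplitz B) (hP : IsMonicOrthogonal B P) {n : ℕ} {q : ℝ[X]}
    (hq : q.natDegree ≤ n) :
    B (X * P n) q = -((P (n + 1)).coeff 0 * q.coeff 0 * B (P n) (P n)) := by
  have key : ∀ q : ℝ[X], q.natDegree ≤ n → B (X * P n) q = q.coeff 0 * B (X * P n) 1 := by
    intro q hq
    -- Splitting off the constant term leaves a multiple of `X`, against which the shift acts.
    have h0 : B (X * P n) (X * q.divX) = 0 := by
      rw [hB.shift]
      rcases Nat.eq_zero_or_pos n with rfl | hn
      · rw [eq_C_of_natDegree_le_zero hq, divX_C, map_zero]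
      · exact hP.apply_of_natDegree_lt (by rw [natDegree_divX_eq_natDegree_tsub_one]; omega)
    conv_lhs => rw [← X_mul_divX_add q]
    rw [map_add, h0, zero_add, ← mul_one (C _), ← smul_eq_C_mul, map_smul, smul_eq_mul]
  -- Pairing `Pₙ₊₁ - X Pₙ` with `Pₙ*` expresses `B (X * P n) 1` through its constant term.
  have h1 := reflect_apply hB hP (hP.natDegree_succ_sub_le n)
  rw [hB.symm, map_sub, LinearMap.sub_apply, hP.apply_of_natDegree_lt
    ((hP.natDegree_reflect_le n).trans_lt (by omega)), key _ (hP.natDegree_reflect_le n),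
    hP.coeff_zero_reflect] at h1
  simp only [coeff_sub, coeff_X_mul_zero, sub_zero] at h1
  rw [key q hq]
  linear_combination (-q.coeff 0) * h1

theorem norm_succ (hB : IsToeplitz B) (hP : IsMonicOrthogonal B P) (n : ℕ) :
    B (P (n + 1)) (P (n + 1)) = (1 - (P (n + 1)).coeff 0 ^ 2) * B (P n) (P n) := by
  have h1 := X_mul_apply hB hP (hP.natDegree_succ_sub_le n)
  have h2 := hP.apply_of_natDegree_le (n := n + 1) (q := X * P n)
    (natDegree_mul_le.trans (by rw [hP.natDegree_eq, natDegree_X]; omega))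
  simp only [map_sub, coeff_sub, coeff_X_mul_zero, sub_zero] at h1
  rw [hB.shift, hB.symm] at h1
  rw [coeff_X_mul, hP.coeff_self, one_mul] at h2
  linear_combination h1 - h2

theorem norm_pos (hB : IsToeplitz B) (hP : IsMonicOrthogonal B P) (n : ℕ) : 0 < B (P n) (P n) :=
  hB.pos _ (hP.monic n).ne_zero

theorem coeff_zero_sq_lt_one (hB : IsToeplitz B) (hP : IsMonicOrthogonal B P) {n : ℕ} (hn : 1 ≤ n) :
    (P n).coeff 0 ^ 2 < 1 := by
  obtain ⟨n, rfl⟩ : ∃ m, n = m + 1 := ⟨n - 1, by omega⟩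
  have h := norm_succ hB hP n
  have h1 := norm_pos hB hP (n + 1)
  rw [h] at h1
  linarith [pos_of_mul_pos_left h1 (norm_pos hB hP n).le]

/-- The discrete Painlevé II equation: the constant term of `X Pₙ₊₁' - (n + 1) Pₙ₊₁`, which has
degree at most `n`, is computed by pairing with `Pₙ*`. -/
theorem discrete_painleve (hB : IsToeplitz B) (hP : IsMonicOrthogonal B P) {t : ℝ}
    (hparts : ∀ p q : ℝ[X], B (X * derivative p) q - B p (X * derivative q)
      = -(t / 2) * (B (X * p) q - B p (X * q))) (n : ℕ) :
    -((n + 1 : ℕ) : ℝ) * (P (n + 1)).coeff 0 = t / 2 * (1 - (P (n + 1)).coeff 0 ^ 2)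
      * ((P (n + 2)).coeff 0 + (P n).coeff 0) := by
  set q := (P n).reflect n with hq
  have hqdeg : q.natDegree ≤ n := hP.natDegree_reflect_le n
  have hq0 : q.coeff 0 = 1 := hP.coeff_zero_reflect n
  have hqn : q.coeff n = (P n).coeff 0 := by
    rw [hq, coeff_reflect, revAt_le le_rfl, Nat.sub_self]
  set g := X * derivative (P (n + 1)) - C ((n + 1 : ℕ) : ℝ) * P (n + 1) with hg
  have hgcoeff : ∀ k, g.coeff k = (k - ((n + 1 : ℕ) : ℝ)) * (P (n + 1)).coeff k := by
    intro k
    rw [hg, coeff_sub, coeff_C_mul]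
    cases k with
    | zero => simp; ring
    | succ k => rw [coeff_X_mul, coeff_derivative]; push_cast; ring
  have hgdeg : g.natDegree ≤ n := by
    rw [natDegree_le_iff_coeff_eq_zero]
    intro N hN
    rw [hgcoeff]
    rcases eq_or_lt_of_le (show n + 1 ≤ N by omega) with rfl | h
    · simp
    · rw [coeff_eq_zero_of_natDegree_lt (by rw [hP.natDegree_eq]; omega), mul_zero]
  have e1 := reflect_apply hB hP hgdeg
  rw [← hq, hB.symm, hgcoeff] at e1
  have e2 := hparts (P (n + 1)) q
  have hXq' : (X * derivative q).natDegree < n + 1 := by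
    refine lt_of_le_of_lt ?_ (Nat.lt_succ_self n)
    rw [natDegree_le_iff_coeff_eq_zero]
    intro N hN
    obtain ⟨N, rfl⟩ : ∃ m, N = m + 1 := ⟨N - 1, by omega⟩
    rw [coeff_X_mul, coeff_derivative, coeff_eq_zero_of_natDegree_lt (by omega), zero_mul]
  rw [hP.apply_of_natDegree_lt hXq', X_mul_apply hB hP (hqdeg.trans (by omega)),
    hP.apply_of_natDegree_le (n := n + 1) (q := X * q)
      (natDegree_mul_le.trans (by rw [natDegree_X]; omega)), coeff_X_mul, hq0, hqn,
    norm_succ hB hP n] at e2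
  have e3 : B g q = B (X * derivative (P (n + 1))) q := by
    rw [hg, map_sub, LinearMap.sub_apply, ← smul_eq_C_mul, map_smul, LinearMap.smul_apply,
      hP.apply_of_natDegree_lt (by omega), smul_zero, sub_zero]
  have h := (norm_pos hB hP n).ne'
  apply mul_right_cancel₀ h
  push_cast at *
  linear_combination e2 + e3 - e1

end IsMonicOrthogonal

/-! ### The form of the modified Bessel weight -/

theorem circleMap_two_pi_sub (θ : ℝ) :
    circleMap 0 1 (2 * Real.pi - θ) = conj (circleMap 0 1 θ) := by
  rw [circleMap_zero, circleMap_zero, map_mul, ← Complex.exp_conj]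
  have : ((2 * Real.pi - θ : ℝ) : ℂ) * Complex.I
      = conj ((θ : ℂ) * Complex.I) + 2 * Real.pi * Complex.I := by
    simp; ring
  rw [this, Complex.exp_add, Complex.exp_two_pi_mul_I]
  simp

theorem circleMap_mul_conj (θ : ℝ) : circleMap 0 1 θ * conj (circleMap 0 1 θ) = 1 := by
  rw [Complex.mul_conj, Complex.normSq_eq_norm_sq]; simp

/-- The inner product of the unit circle with density `exp (t cos θ)` in the angle, restricted to
real polynomials. Only the real part of the integrand is kept (the imaginary part integrates to `0`),
and the constant factor of the Bessel weight is dropped, since it does not affect orthogonality. -/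
noncomputable def besselForm (t : ℝ) : LinearMap.BilinForm ℝ ℝ[X] :=
  LinearMap.mk₂ ℝ (fun p q => ∫ θ in (0 : ℝ)..2 * Real.pi,
      (aeval (circleMap 0 1 θ) p * conj (aeval (circleMap 0 1 θ) q)).re * Real.exp (t * Real.cos θ))
    (fun p p' q => by
      rw [← intervalIntegral.integral_add]
      · congr 1; ext θ
        rw [map_add, add_mul, Complex.add_re, add_mul]
      all_goals exact Continuous.intervalIntegrable (by fun_prop) _ _)
    (fun c p q => by
      rw [smul_eq_mul, ← intervalIntegral.integral_const_mul]
      congr 1; ext θ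
      rw [map_smul, smul_mul_assoc, Complex.smul_re, smul_eq_mul, mul_assoc])
    (fun p q q' => by
      rw [← intervalIntegral.integral_add]
      · congr 1; ext θ
        rw [map_add, map_add, mul_add, Complex.add_re, add_mul]
      all_goals exact Continuous.intervalIntegrable (by fun_prop) _ _)
    (fun c p q => by
      rw [smul_eq_mul, ← intervalIntegral.integral_const_mul]
      congr 1; ext θ
      rw [map_smul, Complex.real_smul, map_mul, Complex.conj_ofReal, mul_left_comm,
        Complex.re_ofReal_mul, mul_assoc])

theorem besselForm_apply (t : ℝ) (p q : ℝ[X]) : besselForm t p q = ∫ θ in (0 : ℝ)..2 * Real.pi,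
    (aeval (circleMap 0 1 θ) p * conj (aeval (circleMap 0 1 θ) q)).re
      * Real.exp (t * Real.cos θ) := rfl

theorem isToeplitz_besselForm (t : ℝ) : IsToeplitz (besselForm t) where
  symm p q := by
    simp only [besselForm_apply]
    congr 1; ext θ
    simp; ring
  shift p q := by
    simp only [besselForm_apply]
    congr 1; ext θ
    congr 2
    rw [map_mul, map_mul, aeval_X, map_mul]
    linear_combination (aeval (circleMap 0 1 θ) p * conj (aeval (circleMap 0 1 θ) q))
      * circleMap_mul_conj θ
  pos p hp := by
    obtain ⟨θ₀, hθ₀, hne⟩ := circle_polynomial_nonzero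
      ((Polynomial.map_ne_zero_iff (algebraMap ℝ ℂ).injective).2 hp)
    rw [eval_map_algebraMap] at hne
    rw [besselForm_apply]
    refine intervalIntegral.integral_pos (by positivity) (Continuous.continuousOn (by fun_prop))
      (fun θ _ => ?_) ⟨θ₀, hθ₀, ?_⟩
    · rw [Complex.mul_conj, Complex.ofReal_re]
      exact mul_nonneg (Complex.normSq_nonneg _) (Real.exp_pos _).le
    · rw [Complex.mul_conj, Complex.ofReal_re]
      exact mul_pos (Complex.normSq_pos.2 hne) (Real.exp_pos _)

/-- The integrand is odd under `θ ↦ 2π - θ`, which conjugates the point of the circle. -/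
theorem integral_im_eq_zero (t : ℝ) (p q : ℝ[X]) : ∫ θ in (0 : ℝ)..2 * Real.pi,
    (aeval (circleMap 0 1 θ) p * conj (aeval (circleMap 0 1 θ) q)).im
      * Real.exp (t * Real.cos θ) = 0 := by
  set F : ℝ → ℝ := fun θ => (aeval (circleMap 0 1 θ) p * conj (aeval (circleMap 0 1 θ) q)).im
      * Real.exp (t * Real.cos θ) with hF
  have h := intervalIntegral.integral_comp_sub_left (a := 0) (b := 2 * Real.pi) F (2 * Real.pi)
  rw [sub_self, sub_zero] at h
  have h2 : ∀ θ, F (2 * Real.pi - θ) = -F θ := by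
    intro θ
    simp only [hF, circleMap_two_pi_sub, aeval_conj, Real.cos_two_pi_sub]
    rw [← map_mul, Complex.conj_im, neg_mul]
  simp only [h2, intervalIntegral.integral_neg] at h
  change ∫ θ in (0 : ℝ)..2 * Real.pi, F θ = 0
  linarith

theorem besselForm_integration_by_parts (t : ℝ) (p q : ℝ[X]) :
    besselForm t (X * derivative p) q - besselForm t p (X * derivative q)
      = -(t / 2) * (besselForm t (X * p) q - besselForm t p (X * q)) := by
  have hd : ∀ (p : ℝ[X]) (θ : ℝ), HasDerivAt (fun θ => aeval (circleMap 0 1 θ) p)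
      (aeval (circleMap 0 1 θ) (derivative p) * (circleMap 0 1 θ * Complex.I)) θ := fun p θ =>
    (p.hasDerivAt_aeval (circleMap 0 1 θ)).comp θ (hasDerivAt_circleMap 0 1 θ)
  have hF : ∀ θ : ℝ, HasDerivAt (fun θ : ℝ =>
      (aeval (circleMap 0 1 θ) p * conj (aeval (circleMap 0 1 θ) q)).im
        * Real.exp (t * Real.cos θ)) (
      ((aeval (circleMap 0 1 θ) (X * derivative p) * conj (aeval (circleMap 0 1 θ) q)).re
        - (aeval (circleMap 0 1 θ) p * conj (aeval (circleMap 0 1 θ) (X * derivative q))).re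
        + t / 2 * ((aeval (circleMap 0 1 θ) (X * p) * conj (aeval (circleMap 0 1 θ) q)).re
        - (aeval (circleMap 0 1 θ) p * conj (aeval (circleMap 0 1 θ) (X * q))).re))
        * Real.exp (t * Real.cos θ)) θ := by
    intro θ
    have h1 := Complex.imCLM.hasFDerivAt.comp_hasDerivAt θ ((hd p θ).mul (hd q θ).star)
    have h2 := (((Real.hasDerivAt_cos θ).const_mul t).exp)
    refine (h1.mul h2).congr_deriv ?_
    have hz : (circleMap 0 1 θ) = (⟨Real.cos θ, Real.sin θ⟩ : ℂ) := by
      rw [circleMap_zero, Complex.exp_mul_I]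
      apply Complex.ext <;> simp [Complex.cos_ofReal_re, Complex.sin_ofReal_re,
        Complex.cos_ofReal_im, Complex.sin_ofReal_im]
    simp only [map_mul, aeval_X, Function.comp_apply, Pi.mul_apply]
    generalize aeval (circleMap 0 1 θ) p = a
    generalize aeval (circleMap 0 1 θ) q = b
    generalize aeval (circleMap 0 1 θ) (derivative p) = a'
    generalize aeval (circleMap 0 1 θ) (derivative q) = b'
    rw [hz]
    simp
    ring
  have h := intervalIntegral.integral_eq_sub_of_hasDerivAt (a := 0) (b := 2 * Real.pi)
    (fun θ _ => hF θ) (Continuous.intervalIntegrable (by fun_prop) _ _)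
  have e : circleMap 0 1 (2 * Real.pi) = circleMap 0 1 0 := by simp [circleMap]
  rw [e, Real.cos_two_pi, Real.cos_zero, sub_self] at h
  have hi : ∀ p q : ℝ[X], IntervalIntegrable (fun θ : ℝ =>
      (aeval (circleMap 0 1 θ) p * conj (aeval (circleMap 0 1 θ) q)).re
      * Real.exp (t * Real.cos θ)) MeasureTheory.volume 0 (2 * Real.pi) := fun p q =>
    Continuous.intervalIntegrable (by fun_prop) _ _
  simp only [add_mul, sub_mul, mul_assoc] at h
  rw [intervalIntegral.integral_add ((hi _ _).sub (hi _ _)) (((hi _ _).sub (hi _ _)).const_mul _),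
    intervalIntegral.integral_const_mul, intervalIntegral.integral_sub (hi _ _) (hi _ _),
    intervalIntegral.integral_sub (hi _ _) (hi _ _)] at h
  simp only [besselForm_apply]
  linarith

theorem besselWeight_circleMap (t θ : ℝ) : besselWeight t (circleMap 0 1 θ)
    = (2 * (Real.pi : ℂ) * (besselI 0 t : ℂ))⁻¹ * (Real.exp (t * Real.cos θ) : ℂ) := by
  have h : (t : ℂ) * (circleMap 0 1 θ + (circleMap 0 1 θ)⁻¹) / 2 = t * Complex.cos θ := by
    rw [Complex.cos, circleMap]
    simp [← Complex.exp_neg]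
    ring
  rw [besselWeight, h, div_eq_inv_mul]
  push_cast
  rfl

/-- Orthogonality as an integral over the angle, with the normalization of the weight removed. -/
theorem besselOPUC_orthogonal (t : ℝ) {m n : ℕ} (h : m ≠ n) : ∫ θ in (0 : ℝ)..2 * Real.pi,
    (besselOPUC t n).eval (circleMap 0 1 θ) * conj ((besselOPUC t m).eval (circleMap 0 1 θ))
      * (Real.exp (t * Real.cos θ) : ℂ) = 0 := by
  have h1 := (besselOPUC_spec t).orthonormal n m
  rw [if_neg h.symm, circleIntegral] at h1
  have hc : (2 * (Real.pi : ℂ) * (besselI 0 t : ℂ))⁻¹ ≠ 0 := by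
    have := (besselI_zero_pos t).ne'
    have := Real.pi_ne_zero
    simp [*]
  rw [← mul_right_inj' hc, mul_zero, ← intervalIntegral.integral_const_mul]
  refine Eq.trans ?_ h1
  congr 1; ext θ
  have hz : circleMap 0 1 θ ≠ 0 := circleMap_ne_center one_ne_zero
  rw [besselWeight_circleMap, deriv_circleMap, smul_eq_mul]
  field_simp

theorem besselOPUC_orthogonal_of_degree_lt (t : ℝ) (n : ℕ) {q : ℂ[X]} (hq : q.degree < n) :
    ∫ θ in (0 : ℝ)..2 * Real.pi, (besselOPUC t n).eval (circleMap 0 1 θ)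
      * conj (q.eval (circleMap 0 1 θ)) * (Real.exp (t * Real.cos θ) : ℂ) = 0 := by
  have key : ∀ m ≤ n, ∀ q : ℂ[X], q.degree < m → ∫ θ in (0 : ℝ)..2 * Real.pi,
      (besselOPUC t n).eval (circleMap 0 1 θ)
      * conj (q.eval (circleMap 0 1 θ)) * (Real.exp (t * Real.cos θ) : ℂ) = 0 := by
    intro m
    induction m with
    | zero =>
      intro _ q hq
      have : q = 0 := by simpa using hq
      simp [this]
    | succ m ih =>
      intro hm q hq
      set f := besselOPUC t m with hf
      obtain ⟨κ, hκ, hlead⟩ := (besselOPUC_spec t).leadingCoeff_pos m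
      have hdeg := (besselOPUC_spec t).natDegree_eq m
      set a := q.coeff m / κ with ha
      have hκ' : (κ : ℂ) ≠ 0 := by exact_mod_cast hκ.ne'
      have hfm : f.coeff m = κ := by
        rw [← hlead, leadingCoeff, hdeg]
      have hlt : (q - C a * f).degree < m := by
        rw [degree_lt_iff_coeff_zero]
        intro N hN
        rw [coeff_sub, coeff_C_mul]
        rcases eq_or_lt_of_le hN with rfl | h
        · rw [hfm, ha, div_mul_cancel₀ _ hκ', sub_self]
        · rw [coeff_eq_zero_of_natDegree_lt (p := f) (by rw [hdeg]; exact h),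
            coeff_eq_zero_of_degree_lt (p := q) (hq.trans_le (by exact_mod_cast h))]
          simp
      have h1 := ih (by omega) _ hlt
      have h2 := besselOPUC_orthogonal t (show m ≠ n by omega)
      have h3 : ∀ θ : ℝ, (besselOPUC t n).eval (circleMap 0 1 θ)
          * conj (q.eval (circleMap 0 1 θ)) * (Real.exp (t * Real.cos θ) : ℂ)
          = (besselOPUC t n).eval (circleMap 0 1 θ)
          * conj ((q - C a * f).eval (circleMap 0 1 θ)) * (Real.exp (t * Real.cos θ) : ℂ)
          + conj a * ((besselOPUC t n).eval (circleMap 0 1 θ)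
          * conj (f.eval (circleMap 0 1 θ)) * (Real.exp (t * Real.cos θ) : ℂ)) := by
        intro θ
        simp
        ring
      simp only [h3]
      rw [intervalIntegral.integral_add, intervalIntegral.integral_const_mul, h1, h2, mul_zero,
        add_zero]
      all_goals exact Continuous.intervalIntegrable (by fun_prop) _ _
  exact key n le_rfl q hq

/-- A complex polynomial is `a + i b` with `a`, `b` the real polynomials formed by the real and
imaginary parts of its coefficients. -/
theorem Polynomial.exists_re_im (p : ℂ[X]) : ∃ a b : ℝ[X],
    (∀ k, a.coeff k = (p.coeff k).re) ∧ (∀ k, b.coeff k = (p.coeff k).im) ∧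
    ∀ z : ℂ, p.eval z = aeval z a + Complex.I * aeval z b := by
  have key : ∀ f : ℂ → ℝ, f 0 = 0 → ∃ a : ℝ[X], ∀ k, a.coeff k = f (p.coeff k) := by
    intro f hf
    refine ⟨∑ i ∈ Finset.range (p.natDegree + 1), monomial i (f (p.coeff i)), fun k => ?_⟩
    rw [finsetSum_coeff]
    simp only [coeff_monomial, Finset.sum_ite_eq', Finset.mem_range]
    split_ifs with h
    · rfl
    · rw [coeff_eq_zero_of_natDegree_lt (by omega), hf]
  obtain ⟨a, ha⟩ := key Complex.re rfl
  obtain ⟨b, hb⟩ := key Complex.im rfl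
  refine ⟨a, b, ha, hb, fun z => ?_⟩
  have : p = a.map (algebraMap ℝ ℂ) + C Complex.I * b.map (algebraMap ℝ ℂ) := by
    ext k
    rw [coeff_add, coeff_C_mul, coeff_map, coeff_map, ha, hb, mul_comm Complex.I]
    exact (Complex.re_add_im _).symm
  rw [this, eval_add, eval_mul, eval_C, eval_map_algebraMap, eval_map_algebraMap]

/-- The orthonormal polynomials of the Bessel weight are positive multiples of real monic
orthogonal polynomials. The moments being real, orthogonality holds for the real and imaginary parts
of the coefficients separately; the imaginary part has degree less than `n`, so it is orthogonal to
itself and vanishes. -/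
theorem exists_isMonicOrthogonal_besselForm (t : ℝ) : ∃ P : ℕ → ℝ[X],
    IsMonicOrthogonal (besselForm t) P ∧ ∀ n, reflectionCoeff n t = ((P n).coeff 0 : ℂ) := by
  have key : ∀ n, ∃ p : ℝ[X], p.natDegree = n ∧ p.Monic ∧
      (∀ j, j < n → besselForm t p (X ^ j) = 0) ∧ reflectionCoeff n t = (p.coeff 0 : ℂ) := by
    intro n
    set f := besselOPUC t n with hf
    obtain ⟨κ, hκ, hlead⟩ := (besselOPUC_spec t).leadingCoeff_pos n
    have hdeg : f.natDegree = n := (besselOPUC_spec t).natDegree_eq n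
    have hfn : f.coeff n = κ := by rw [← hlead, leadingCoeff, hdeg]
    obtain ⟨a, b, ha, hb, hab⟩ := f.exists_re_im
    have horth : ∀ j, j < n → besselForm t a (X ^ j) = 0 ∧ besselForm t b (X ^ j) = 0 := by
      intro j hj
      have h := besselOPUC_orthogonal_of_degree_lt t n (q := X ^ j) (by simpa using hj)
      have h1 : ∀ θ : ℝ, f.eval (circleMap 0 1 θ)
          * conj ((X ^ j : ℂ[X]).eval (circleMap 0 1 θ)) * (Real.exp (t * Real.cos θ) : ℂ)
          = (((aeval (circleMap 0 1 θ) a * conj (aeval (circleMap 0 1 θ) (X ^ j : ℝ[X]))).re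
            * Real.exp (t * Real.cos θ)
            - (aeval (circleMap 0 1 θ) b * conj (aeval (circleMap 0 1 θ) (X ^ j : ℝ[X]))).im
            * Real.exp (t * Real.cos θ) : ℝ) : ℂ) +
            (((aeval (circleMap 0 1 θ) b * conj (aeval (circleMap 0 1 θ) (X ^ j : ℝ[X]))).re
            * Real.exp (t * Real.cos θ)
            + (aeval (circleMap 0 1 θ) a * conj (aeval (circleMap 0 1 θ) (X ^ j : ℝ[X]))).im
            * Real.exp (t * Real.cos θ) : ℝ) : ℂ) * Complex.I := by
        intro θ
        rw [hab, map_pow, aeval_X, eval_pow, eval_X]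
        generalize aeval (circleMap 0 1 θ) a = u
        generalize aeval (circleMap 0 1 θ) b = v
        generalize circleMap 0 1 θ ^ j = w
        generalize Real.exp (t * Real.cos θ) = e
        apply Complex.ext <;> simp <;> ring
      simp only [← hf, h1] at h
      rw [intervalIntegral.integral_add, intervalIntegral.integral_mul_const,
        intervalIntegral.integral_ofReal, intervalIntegral.integral_ofReal,
        intervalIntegral.integral_sub, intervalIntegral.integral_add, integral_im_eq_zero,
        integral_im_eq_zero, ← besselForm_apply, ← besselForm_apply, sub_zero, add_zero] at h
      · rw [Complex.ext_iff] at h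
        simpa using h
      all_goals exact Continuous.intervalIntegrable (by fun_prop) _ _
    have hB := isToeplitz_besselForm t
    have hb0 : b = 0 := by
      by_contra hne
      refine (hB.pos b hne).ne' ?_
      have hbdeg : b.natDegree ≤ n := by
        rw [natDegree_le_iff_coeff_eq_zero]
        intro N hN
        rw [hb, coeff_eq_zero_of_natDegree_lt (by omega), Complex.zero_im]
      rw [(besselForm t b).apply_eq_sum_coeff_mul_X_pow hbdeg]
      refine Finset.sum_eq_zero fun j hj => ?_
      rcases eq_or_lt_of_le (show j ≤ n by simpa [Nat.lt_succ_iff] using hj) with rfl | h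
      · rw [hb, hfn, Complex.ofReal_im, zero_mul]
      · rw [(horth j h).2, mul_zero]
    have hadeg : a.natDegree ≤ n := by
      rw [natDegree_le_iff_coeff_eq_zero]
      intro N hN
      rw [ha, coeff_eq_zero_of_natDegree_lt (by omega), Complex.zero_re]
    have hcn : (C κ⁻¹ * a).coeff n = 1 := by
      rw [coeff_C_mul, ha, hfn, Complex.ofReal_re, inv_mul_cancel₀ hκ.ne']
    have hle : (C κ⁻¹ * a).natDegree ≤ n := (natDegree_C_mul_le _ _).trans hadeg
    refine ⟨C κ⁻¹ * a, ?_, monic_of_natDegree_le_of_coeff_eq_one n hle hcn, fun j hj => ?_, ?_⟩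
    · exact natDegree_eq_of_le_of_coeff_ne_zero hle (by rw [hcn]; exact one_ne_zero)
    · rw [← smul_eq_C_mul, map_smul, LinearMap.smul_apply, (horth j hj).1, smul_zero]
    · rw [reflectionCoeff, ← hf, hlead, hab, hb0, map_zero, mul_zero, add_zero, coeff_C_mul,
        ← coeff_zero_eq_aeval_zero', div_eq_inv_mul]
      push_cast
      rfl
  choose P h1 h2 h3 h4 using key
  exact ⟨P, ⟨h2, h1, h3⟩, h4⟩

/-! ### Recurrence and first order system of the reflection coefficients -/

/-- The reflection coefficient as a real number; no information is lost, by
`reflectionCoeff_eq_verblunsky`. The sign convention is `rₙ = Pₙ(0)`. -/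
noncomputable def verblunsky (n : ℕ) (t : ℝ) : ℝ := (reflectionCoeff n t).re

theorem reflectionCoeff_eq_verblunsky (n : ℕ) (t : ℝ) :
    reflectionCoeff n t = (verblunsky n t : ℂ) := by
  obtain ⟨P, -, h⟩ := exists_isMonicOrthogonal_besselForm t
  rw [verblunsky, h, Complex.ofReal_re]

theorem exists_isMonicOrthogonal_coeff_zero (t : ℝ) : ∃ P : ℕ → ℝ[X],
    IsMonicOrthogonal (besselForm t) P ∧ ∀ n, verblunsky n t = (P n).coeff 0 := by
  obtain ⟨P, hP, h⟩ := exists_isMonicOrthogonal_besselForm t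
  exact ⟨P, hP, fun n => by rw [verblunsky, h, Complex.ofReal_re]⟩

theorem verblunsky_sq_lt_one {n : ℕ} (hn : 1 ≤ n) (t : ℝ) : verblunsky n t ^ 2 < 1 := by
  obtain ⟨P, hP, h⟩ := exists_isMonicOrthogonal_coeff_zero t
  rw [h]
  exact hP.coeff_zero_sq_lt_one (isToeplitz_besselForm t) hn

theorem verblunsky_recurrence (n : ℕ) (t : ℝ) :
    -((n : ℝ) + 1) * verblunsky (n + 1) t = t / 2 * (1 - verblunsky (n + 1) t ^ 2)
      * (verblunsky (n + 2) t + verblunsky n t) := by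
  obtain ⟨P, hP, h⟩ := exists_isMonicOrthogonal_coeff_zero t
  rw [h, h, h]
  exact_mod_cast hP.discrete_painleve (isToeplitz_besselForm t)
    (besselForm_integration_by_parts t) n

theorem verblunsky_zero (t : ℝ) : verblunsky 0 t = 1 := by
  obtain ⟨P, hP, h⟩ := exists_isMonicOrthogonal_coeff_zero t
  rw [h, hP.zero, coeff_one_zero]

/-- The `k`-th derivative of `2π I₀(t) = ∫ exp (t cos θ) dθ`, in integral form. -/
noncomputable def besselMoment (k : ℕ) (t : ℝ) : ℝ :=
  ∫ θ in (0 : ℝ)..2 * Real.pi, Real.cos θ ^ k * Real.exp (t * Real.cos θ)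

theorem hasDerivAt_besselMoment (k : ℕ) (t : ℝ) :
    HasDerivAt (besselMoment k) (besselMoment (k + 1) t) t := by
  refine (intervalIntegral.hasDerivAt_integral_of_dominated_loc_of_deriv_le
    (F := fun t θ => Real.cos θ ^ k * Real.exp (t * Real.cos θ))
    (F' := fun t θ => Real.cos θ ^ (k + 1) * Real.exp (t * Real.cos θ))
    (bound := fun _ => Real.exp (|t| + 1))
    (Metric.ball_mem_nhds t one_pos) (.of_forall fun s => ?_) ?_ ?_
    (.of_forall fun θ _ s hs => ?_) (by simp) (.of_forall fun θ _ s _ => ?_)).2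
  · exact Continuous.aestronglyMeasurable (by fun_prop)
  · exact Continuous.intervalIntegrable (by fun_prop) _ _
  · exact Continuous.aestronglyMeasurable (by fun_prop)
  · have hs : |s - t| < 1 := by simpa [Real.dist_eq] using hs
    have h1 : |s * Real.cos θ| ≤ |t| + 1 := by
      rw [abs_mul]
      have := Real.abs_cos_le_one θ
      have := abs_sub_abs_le_abs_sub s t
      nlinarith [abs_nonneg s, abs_nonneg (Real.cos θ)]
    rw [Real.norm_eq_abs, abs_mul, abs_pow, Real.abs_exp]
    calc _ ≤ 1 * Real.exp (s * Real.cos θ) := by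
          gcongr
          exact pow_le_one₀ (abs_nonneg _) (Real.abs_cos_le_one θ)
      _ ≤ _ := by
          rw [one_mul]
          exact Real.exp_le_exp.2 ((le_abs_self _).trans h1)
  · have := (((hasDerivAt_id s).mul_const (Real.cos θ)).exp).const_mul (Real.cos θ ^ k)
    refine this.congr_deriv ?_
    simp
    ring

theorem besselForm_one_one (t : ℝ) : besselForm t 1 1 = besselMoment 0 t := by
  rw [besselForm_apply, besselMoment]
  congr 1; ext θ
  simp

theorem besselForm_X_one (t : ℝ) : besselForm t X 1 = besselMoment 1 t := by
  rw [besselForm_apply, besselMoment]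
  congr 1; ext θ
  simp [circleMap_zero, Complex.exp_ofReal_mul_I_re]

theorem besselMoment_zero_pos (t : ℝ) : 0 < besselMoment 0 t := by
  rw [← besselForm_one_one]
  exact (isToeplitz_besselForm t).pos 1 one_ne_zero

/-- Bessel's equation for `I₀`, by integrating the derivative of `sin θ exp (t cos θ)`. -/
theorem besselMoment_two (t : ℝ) :
    t * besselMoment 2 t = t * besselMoment 0 t - besselMoment 1 t := by
  have hF : ∀ θ : ℝ, HasDerivAt (fun θ : ℝ => Real.sin θ * Real.exp (t * Real.cos θ))
      (Real.cos θ ^ 1 * Real.exp (t * Real.cos θ)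
        + (t * (Real.cos θ ^ 2 * Real.exp (t * Real.cos θ))
          - t * (Real.cos θ ^ 0 * Real.exp (t * Real.cos θ)))) θ := by
    intro θ
    refine ((Real.hasDerivAt_sin θ).mul ((Real.hasDerivAt_cos θ).const_mul t).exp).congr_deriv ?_
    linear_combination (-t * Real.exp (t * Real.cos θ)) * Real.sin_sq_add_cos_sq θ
  have h := intervalIntegral.integral_eq_sub_of_hasDerivAt (a := 0) (b := 2 * Real.pi)
    (fun θ _ => hF θ) (Continuous.intervalIntegrable (by fun_prop) _ _)
  have hi : ∀ k : ℕ, IntervalIntegrable (fun θ : ℝ =>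
      Real.cos θ ^ k * Real.exp (t * Real.cos θ)) MeasureTheory.volume 0 (2 * Real.pi) :=
    fun k => Continuous.intervalIntegrable (by fun_prop) _ _
  rw [intervalIntegral.integral_add (hi _) (((hi _).const_mul t).sub ((hi _).const_mul t)),
    intervalIntegral.integral_sub ((hi _).const_mul t) ((hi _).const_mul t),
    intervalIntegral.integral_const_mul, intervalIntegral.integral_const_mul] at h
  simp only [Real.sin_two_pi, Real.sin_zero, zero_mul, sub_zero] at h
  simp only [besselMoment]
  linarith

theorem verblunsky_one (t : ℝ) : verblunsky 1 t = -(besselMoment 1 t / besselMoment 0 t) := by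
  obtain ⟨P, hP, h⟩ := exists_isMonicOrthogonal_coeff_zero t
  have h1 := hP.X_mul_apply (isToeplitz_besselForm t) (n := 0) (q := 1) (by simp)
  rw [hP.zero, mul_one, besselForm_X_one, besselForm_one_one, coeff_one_zero] at h1
  rw [h, h1]
  have := (besselMoment_zero_pos t).ne'
  field_simp

/-- The first order system satisfied by two consecutive reflection coefficients. -/
theorem hasDerivAt_verblunsky (n : ℕ) {t : ℝ} (ht : t ≠ 0) :
    HasDerivAt (verblunsky n)
      (n / t * verblunsky n t + (1 - verblunsky n t ^ 2) * verblunsky (n + 1) t) t ∧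
    HasDerivAt (verblunsky (n + 1))
      (-((n + 1) / t * verblunsky (n + 1) t)
        - (1 - verblunsky (n + 1) t ^ 2) * verblunsky n t) t := by
  induction n generalizing t with
  | zero =>
    have h0 : verblunsky 0 = fun _ => 1 := funext verblunsky_zero
    have h1 : verblunsky 1 = fun t => -(besselMoment 1 t / besselMoment 0 t) :=
      funext verblunsky_one
    rw [h0]
    refine ⟨(hasDerivAt_const t (1 : ℝ)).congr_deriv (by simp), ?_⟩
    rw [h1]
    have hne := (besselMoment_zero_pos t).ne'
    refine ((hasDerivAt_besselMoment 1 t).div (hasDerivAt_besselMoment 0 t) hne).neg.congr_deriv ?_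
    have h2 : besselMoment 2 t = besselMoment 0 t - besselMoment 1 t / t := by
      have := besselMoment_two t
      field_simp
      linarith
    simp only [zero_add, one_add_one_eq_two, h2]
    field_simp
    simp
    ring
  | succ n ih =>
    have hrec : ∀ s : ℝ, s ≠ 0 → verblunsky (n + 2) s
        = -(2 * (n + 1) / s * (verblunsky (n + 1) s / (1 - verblunsky (n + 1) s ^ 2)))
          - verblunsky n s := by
      intro s hs
      have h1 : 1 - verblunsky (n + 1) s ^ 2 ≠ 0 :=
        (sub_pos.2 (verblunsky_sq_lt_one (by omega) s)).ne'
      have h2 := verblunsky_recurrence n s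
      field_simp
      linear_combination (-2) * h2
    obtain ⟨hy, hx⟩ := ih ht
    have hne : 1 - verblunsky (n + 1) t ^ 2 ≠ 0 :=
        (sub_pos.2 (verblunsky_sq_lt_one (by omega) t)).ne'
    constructor
    · refine hx.congr_deriv ?_
      rw [hrec t ht]
      push_cast
      field_simp
      ring
    · have heq : verblunsky (n + 2) =ᶠ[𝓝 t] fun s => -(2 * (n + 1) / s
          * (verblunsky (n + 1) s / (1 - verblunsky (n + 1) s ^ 2))) - verblunsky n s :=
        (eventually_ne_nhds ht).mono hrec
      have hd := ((((hasDerivAt_const t (2 * ((n : ℝ) + 1))).div (hasDerivAt_id t) ht).mul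
        (hx.div ((hx.pow 2).const_sub 1) hne)).neg.sub hy)
      refine (hd.congr_of_eventuallyEq heq).congr_deriv ?_
      rw [show n + 1 + 1 = n + 2 from rfl, hrec t ht]
      simp only [id, Pi.div_apply, Pi.pow_apply]
      push_cast
      generalize verblunsky (n + 1) t = x at *
      generalize verblunsky n t = y at *
      field_simp
      ring

/-! ### Second order equation, expansion at the origin, and Painlevé V -/

theorem deriv_verblunsky (n : ℕ) {t : ℝ} (ht : t ≠ 0) : deriv (verblunsky (n + 1)) t =
    -((n + 1) / t * verblunsky (n + 1) t) - (1 - verblunsky (n + 1) t ^ 2) * verblunsky n t :=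
  (hasDerivAt_verblunsky n ht).2.deriv

theorem hasDerivAt_deriv_verblunsky (n : ℕ) {t : ℝ} (ht : t ≠ 0) :
    HasDerivAt (deriv (verblunsky (n + 1)))
      (1 / 2 * (1 / (verblunsky (n + 1) t + 1) + 1 / (verblunsky (n + 1) t - 1))
          * deriv (verblunsky (n + 1)) t ^ 2
        - 1 / t * deriv (verblunsky (n + 1)) t
        - verblunsky (n + 1) t * (1 - verblunsky (n + 1) t ^ 2)
        + (n + 1 : ℝ) ^ 2 / t ^ 2
          * (verblunsky (n + 1) t / (1 - verblunsky (n + 1) t ^ 2))) t := by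
  obtain ⟨hy, hx⟩ := hasDerivAt_verblunsky n ht
  have heq : deriv (verblunsky (n + 1)) =ᶠ[𝓝 t] fun s => -((n + 1) / s * verblunsky (n + 1) s)
      - (1 - verblunsky (n + 1) s ^ 2) * verblunsky n s :=
    (eventually_ne_nhds ht).mono fun s hs => deriv_verblunsky n hs
  have hd := (((hasDerivAt_const t ((n : ℝ) + 1)).div (hasDerivAt_id t) ht).mul hx).neg.sub
    (((hx.pow 2).const_sub 1).mul hy)
  refine (hd.congr_of_eventuallyEq heq).congr_deriv ?_
  have hne : verblunsky (n + 1) t ^ 2 < 1 := verblunsky_sq_lt_one (by omega) t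
  have h1 : verblunsky (n + 1) t + 1 ≠ 0 := fun h => by
    rw [eq_neg_of_add_eq_zero_left h] at hne; norm_num at hne
  have h2 : verblunsky (n + 1) t - 1 ≠ 0 := fun h => by
    rw [sub_eq_zero.1 h] at hne; norm_num at hne
  have h3 : 1 - verblunsky (n + 1) t ^ 2
      = -((verblunsky (n + 1) t + 1) * (verblunsky (n + 1) t - 1)) := by
    ring
  rw [deriv_verblunsky n ht]
  simp only [id, Pi.div_apply, Pi.pow_apply]
  push_cast
  generalize verblunsky (n + 1) t = x at *
  generalize verblunsky n t = y at *
  rw [h3]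
  field_simp
  ring

/-- A bound on a derivative near `0` is integrated, by the mean value theorem on the segment from
`0` to `t`; no derivative at `0` itself is required. -/
theorem isBigO_pow_succ_of_hasDerivAt {f f' : ℝ → ℝ} {m : ℕ} (hf : ∀ t ≠ 0, HasDerivAt f (f' t) t)
    (hcont : ContinuousAt f 0) (h0 : f 0 = 0) (hf' : f' =O[𝓝[≠] 0] fun t => t ^ m) :
    f =O[𝓝[≠] 0] fun t => t ^ (m + 1) := by
  obtain ⟨C, hC, hbound⟩ := hf'.exists_pos
  rw [isBigOWith_iff, eventually_nhdsWithin_iff, Metric.eventually_nhds_iff] at hbound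
  obtain ⟨δ, hδ, hbound⟩ := hbound
  refine IsBigO.of_bound C ?_
  rw [eventually_nhdsWithin_iff, Metric.eventually_nhds_iff]
  refine ⟨δ, hδ, fun t ht ht0 => ?_⟩
  have ht0 : t ≠ 0 := ht0
  have hcont' : ∀ s, ContinuousAt f s := fun s => by
    rcases eq_or_ne s 0 with rfl | hs
    · exact hcont
    · exact (hf s hs).continuousAt
  have hg : ∀ s ∈ Set.Ioo (0 : ℝ) 1, HasDerivAt (fun s => f (s * t)) (f' (s * t) * t) s :=
    fun s hs => (hf (s * t) (mul_ne_zero hs.1.ne' ht0)).comp s (hasDerivAt_mul_const t)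
  -- The segment is parametrized by `[0, 1]`, so that both signs of `t` are treated at once.
  obtain ⟨c, hc, hslope⟩ := exists_hasDerivAt_eq_slope (fun s => f (s * t)) _ one_pos
    (fun s _ => ContinuousAt.continuousWithinAt
      (ContinuousAt.comp (f := fun s => s * t) (hcont' _) (by fun_prop))) hg
  simp only [one_mul, zero_mul, h0, sub_zero, div_one] at hslope
  have hct : |c * t| ≤ |t| := by
    rw [abs_mul, abs_of_pos hc.1]
    exact mul_le_of_le_one_left (abs_nonneg t) hc.2.le
  rw [dist_zero_right, Real.norm_eq_abs] at ht
  have hb := hbound (y := c * t) (by rw [dist_zero_right, Real.norm_eq_abs]; exact hct.trans_lt ht)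
    (mul_ne_zero hc.1.ne' ht0)
  rw [← hslope, norm_mul, norm_pow, pow_succ, ← mul_assoc]
  refine mul_le_mul_of_nonneg_right (hb.trans ?_) (norm_nonneg t)
  rw [norm_pow]
  exact mul_le_mul_of_nonneg_left (pow_le_pow_left₀ (norm_nonneg _) hct m) hC.le

/-- Integration of `(tⁿ⁺¹ rₙ₊₁)' = -tⁿ⁺¹ (1 - rₙ₊₁²) rₙ`, after subtracting two monomials and
with the factor `tⁿ⁺¹` cancelled on both sides. -/
theorem isBigO_verblunsky_succ_sub {n m : ℕ} {c d : ℝ}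
    (h : (fun t => -((1 - verblunsky (n + 1) t ^ 2) * verblunsky n t)
      - c * (2 * n + 2) * t ^ n - d * (2 * n + 4) * t ^ (n + 2)) =O[𝓝[≠] 0] fun t => t ^ m) :
    (fun t => verblunsky (n + 1) t - c * t ^ (n + 1) - d * t ^ (n + 3))
      =O[𝓝[≠] 0] fun t => t ^ (m + 1) := by
  have hlim : ContinuousAt (fun t => t ^ (n + 1) * verblunsky (n + 1) t) 0 := by
    have h1 : Tendsto (fun t : ℝ => |t| ^ (n + 1)) (𝓝 0) (𝓝 0) := by
      have : Continuous fun t : ℝ => |t| ^ (n + 1) := by fun_prop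
      simpa using this.tendsto 0
    have h2 := squeeze_zero_norm (f := fun t => t ^ (n + 1) * verblunsky (n + 1) t) (fun t => by
      rw [norm_mul, norm_pow, Real.norm_eq_abs, Real.norm_eq_abs]
      exact mul_le_of_le_one_right (by positivity)
        (abs_le_one_iff_mul_self_le_one.2 (by
          have := verblunsky_sq_lt_one (n := n + 1) (by omega) t
          nlinarith))) h1
    simpa [ContinuousAt] using h2
  have key := isBigO_pow_succ_of_hasDerivAt
    (f := fun t => t ^ (n + 1) * verblunsky (n + 1) t - c * t ^ (2 * n + 2) - d * t ^ (2 * n + 4))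
    (f' := fun t => t ^ (n + 1) * (-((1 - verblunsky (n + 1) t ^ 2) * verblunsky n t)
      - c * (2 * n + 2) * t ^ n - d * (2 * n + 4) * t ^ (n + 2))) (m := n + 1 + m)
    (fun t ht => ?_) ((hlim.sub (by fun_prop)).sub (by fun_prop)) (by simp)
    (by simpa only [pow_add _ (n + 1) m] using (isBigO_refl _ _).mul h)
  · refine (((isBigO_refl (fun t : ℝ => (t ^ (n + 1))⁻¹) (𝓝[≠] 0)).mul key).congr' ?_ ?_)
    all_goals
      refine eventually_mem_nhdsWithin.mono fun t (ht : t ≠ 0) => ?_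
      field_simp
      ring
  · refine ((((hasDerivAt_pow (n + 1) t).mul (hasDerivAt_verblunsky n ht).2).sub
      ((hasDerivAt_pow (2 * n + 2) t).const_mul c)).sub
      ((hasDerivAt_pow (2 * n + 4) t).const_mul d)).congr_deriv ?_
    simp only [Nat.add_sub_cancel, show 2 * n + 2 - 1 = 2 * n + 1 by omega,
      show 2 * n + 4 - 1 = 2 * n + 3 by omega]
    push_cast
    field_simp
    ring

theorem isBigO_pow_of_le {a b : ℕ} (h : a ≤ b) :
    (fun t : ℝ => t ^ b) =O[𝓝[≠] 0] fun t : ℝ => t ^ a := by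
  have h1 : (fun t : ℝ => t ^ (b - a)) =O[𝓝[≠] 0] fun _ => (1 : ℝ) :=
    ((continuous_pow (b - a)).continuousAt.tendsto.isBigO_one ℝ).mono nhdsWithin_le_nhds
  refine ((isBigO_refl (fun t : ℝ => t ^ a) _).mul h1).congr (fun t => ?_) fun t => mul_one _
  rw [← pow_add, Nat.add_sub_cancel' h]

theorem verblunsky_isBigO_pow (n : ℕ) : verblunsky n =O[𝓝[≠] 0] fun t => t ^ n := by
  induction n with
  | zero =>
    rw [show verblunsky 0 = fun _ => 1 from funext verblunsky_zero]
    simpa using isBigO_refl (fun _ : ℝ => (1 : ℝ)) (𝓝[≠] 0)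
  | succ n ih =>
    have h1 : (fun t => 1 - verblunsky (n + 1) t ^ 2) =O[𝓝[≠] 0] fun _ => (1 : ℝ) := by
      refine IsBigO.of_bound 1 (.of_forall fun t => ?_)
      have := verblunsky_sq_lt_one (n := n + 1) (by omega) t
      rw [Real.norm_eq_abs, norm_one, abs_le]
      constructor <;> nlinarith [sq_nonneg (verblunsky (n + 1) t)]
    have h := isBigO_verblunsky_succ_sub (n := n) (m := n) (c := 0) (d := 0)
      (by simpa using (h1.mul ih))
    simpa using h

/-- The case `r₁` is separate because `r₁²` contributes to the second term of its own expansion;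
the leading term `-t / 2` is found first and then substituted. For larger indices `rₙ²` is of higher
order. -/
theorem verblunsky_one_expansion :
    (fun t => verblunsky 1 t - -1 / 2 * t ^ 1 - 1 / 16 * t ^ 3) =O[𝓝[≠] 0] fun t => t ^ 5 := by
  have h1 := verblunsky_isBigO_pow 1
  have h2 : (fun t => verblunsky 1 t + 1 / 2 * t) =O[𝓝[≠] 0] fun t => t ^ 3 := by
    have := isBigO_verblunsky_succ_sub (n := 0) (m := 2) (c := -1 / 2) (d := 0) ?_
    · refine this.congr_left fun t => ?_
      ring
    · refine (h1.pow 2).congr (fun t => ?_) fun t => by ring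
      rw [verblunsky_zero]
      norm_num
  have h3 : (fun t : ℝ => verblunsky 1 t - 1 / 2 * t) =O[𝓝[≠] 0] fun t => t ^ 1 := by
    refine h1.sub ?_
    simpa using (isBigO_refl (fun t : ℝ => t) (𝓝[≠] 0)).const_mul_left (1 / 2)
  refine isBigO_verblunsky_succ_sub (n := 0) (m := 4)
    ((h2.mul h3).congr (fun t => ?_) fun t => by ring)
  rw [verblunsky_zero]
  norm_num
  ring

theorem verblunsky_expansion (n : ℕ) :
    (fun t => verblunsky (n + 1) t - (-1 / 2) ^ (n + 1) / (n + 1).factorial * t ^ (n + 1)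
      - -((-1 / 2) ^ (n + 1) / (n + 1).factorial / (4 * (n + 2))) * t ^ (n + 3))
      =O[𝓝[≠] 0] fun t => t ^ (n + 5) := by
  induction n with
  | zero =>
    convert verblunsky_one_expansion using 2
    norm_num
  | succ n ih =>
    have h1 := (((verblunsky_isBigO_pow (n + 2)).pow 2).mul (verblunsky_isBigO_pow (n + 1)))
    have h2 := (ih.neg_left).add (h1.trans ((isBigO_pow_of_le (a := n + 5)
      (b := (n + 2) * 2 + (n + 1)) (by omega)).congr_left fun t => by ring))
    refine isBigO_verblunsky_succ_sub (n := n + 1) (m := n + 5) (h2.congr_left fun t => ?_)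
    rw [Nat.factorial_succ (n + 1)]
    have : ((n + 1).factorial : ℝ) ≠ 0 := by positivity
    push_cast
    field_simp
    ring

/-- The inverse substitution `z = (r + 1) / (r - 1)` turns the second order equation of `r` into
the fifth Painlevé equation for `z`. -/
theorem solvesPainleveV_of_moebius {r z : ℝ → ℂ} {n : ℂ} (hr1 : ∀ t ≠ 0, r t ≠ 1)
    (hr2 : ∀ t ≠ 0, r t ≠ -1)
    (hd : ∀ t ≠ 0, DifferentiableAt ℝ r t) (hd2 : ∀ t ≠ 0, HasDerivAt (deriv r)
      (1 / 2 * (1 / (r t + 1) + 1 / (r t - 1)) * deriv r t ^ 2 - 1 / (t : ℂ) * deriv r t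
        - r t * (1 - r t ^ 2) + n ^ 2 / (t : ℂ) ^ 2 * (r t / (1 - r t ^ 2))) t)
    (hz : ∀ t : ℝ, t ≠ 0 → z t ≠ 1 ∧ r t = (z t + 1) / (z t - 1)) :
    SolvesPainleveV (n ^ 2 / 8) (-(n ^ 2 / 8)) 0 (-2) z {t : ℝ | t ≠ 0} := by
  have hz' : ∀ t ≠ 0, z t = (r t + 1) / (r t - 1) := by
    intro t ht
    obtain ⟨h1, h2⟩ := hz t ht
    have h3 := sub_ne_zero.2 h1
    have h4 := sub_ne_zero.2 (hr1 t ht)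
    rw [eq_div_iff h3] at h2
    rw [eq_div_iff h4]
    linear_combination h2
  have hzd : ∀ t ≠ 0, HasDerivAt z (-2 * deriv r t / (r t - 1) ^ 2) t := by
    intro t ht
    have heq : z =ᶠ[𝓝 t] fun s => (r s + 1) / (r s - 1) := (eventually_ne_nhds ht).mono hz'
    have h := (hd t ht).hasDerivAt
    refine (((h.add_const 1).div (h.sub_const 1) (sub_ne_zero.2 (hr1 t ht))).congr_of_eventuallyEq
      heq).congr_deriv ?_
    ring
  intro t ht
  have ht : t ≠ 0 := ht
  have h1 := sub_ne_zero.2 (hr1 t ht)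
  have h2 : r t + 1 ≠ 0 := fun h => hr2 t ht (eq_neg_of_add_eq_zero_left h)
  have heq : deriv z =ᶠ[𝓝 t] fun s => -2 * deriv r s / (r s - 1) ^ 2 :=
    (eventually_ne_nhds ht).mono fun s hs => (hzd s hs).deriv
  have hzdd := (((hd2 t ht).const_mul (-2 : ℂ)).div
    (((hd t ht).hasDerivAt.sub_const 1).pow 2) (pow_ne_zero 2 h1)).congr_of_eventuallyEq heq
  have hz0 : z t ≠ 0 := by
    rw [hz' t ht]
    exact div_ne_zero h2 h1
  refine ⟨ht, hz0, (hz t ht).1, (hzd t ht).differentiableAt, hzdd.differentiableAt, ?_⟩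
  have htc : (t : ℂ) ≠ 0 := by exact_mod_cast ht
  have h3 : z t - 1 = 2 / (r t - 1) := by
    rw [hz' t ht]
    field_simp
    ring
  rw [hzdd.deriv, (hzd t ht).deriv, h3, hz' t ht,
    show 1 - r t ^ 2 = -((r t + 1) * (r t - 1)) by ring]
  simp only [Pi.pow_apply]
  generalize deriv r t = r' at *
  generalize r t = x at *
  field_simp
  push_cast
  ring

/-! ### Complex-valued reflection coefficients -/

theorem hasDerivAt_reflectionCoeff (n : ℕ) {t : ℝ} (ht : t ≠ 0) :
    HasDerivAt (reflectionCoeff (n + 1)) ((deriv (verblunsky (n + 1)) t : ℝ) : ℂ) t := by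
  rw [show reflectionCoeff (n + 1) = fun s => (verblunsky (n + 1) s : ℂ) from
    funext (reflectionCoeff_eq_verblunsky (n + 1))]
  exact (hasDerivAt_verblunsky n ht).2.differentiableAt.hasDerivAt.ofReal_comp

theorem hasDerivAt_deriv_reflectionCoeff (n : ℕ) {t : ℝ} (ht : t ≠ 0) :
    HasDerivAt (deriv (reflectionCoeff (n + 1)))
      (1 / 2 * (1 / (reflectionCoeff (n + 1) t + 1) + 1 / (reflectionCoeff (n + 1) t - 1))
          * deriv (reflectionCoeff (n + 1)) t ^ 2
        - 1 / (t : ℂ) * deriv (reflectionCoeff (n + 1)) t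
        - reflectionCoeff (n + 1) t * (1 - reflectionCoeff (n + 1) t ^ 2)
        + ((n + 1 : ℕ) : ℂ) ^ 2 / (t : ℂ) ^ 2
          * (reflectionCoeff (n + 1) t / (1 - reflectionCoeff (n + 1) t ^ 2))) t := by
  have heq : deriv (reflectionCoeff (n + 1)) =ᶠ[𝓝 t]
      fun s => ((deriv (verblunsky (n + 1)) s : ℝ) : ℂ) :=
    (eventually_ne_nhds ht).mono fun s hs => (hasDerivAt_reflectionCoeff n hs).deriv
  refine ((hasDerivAt_deriv_verblunsky n ht).ofReal_comp.congr_of_eventuallyEq heq).congr_deriv ?_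
  rw [(hasDerivAt_reflectionCoeff n ht).deriv, reflectionCoeff_eq_verblunsky]
  push_cast
  rfl

theorem reflectionCoeff_ne_one_and_ne_neg_one {n : ℕ} (hn : 1 ≤ n) (t : ℝ) :
    reflectionCoeff n t ≠ 1 ∧ reflectionCoeff n t ≠ -1 := by
  have h := verblunsky_sq_lt_one hn t
  rw [reflectionCoeff_eq_verblunsky]
  constructor <;> intro h1
  · rw [show verblunsky n t = 1 by exact_mod_cast h1] at h
    norm_num at h
  · rw [show verblunsky n t = -1 by exact_mod_cast h1] at h
    norm_num at h

theorem reflectionCoeff_expansion (n : ℕ) :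
    ∃ E : ℝ → ℂ, E =O[𝓝[≠] 0] (fun t : ℝ => t ^ 4) ∧
      ∀ t : ℝ, t ≠ 0 → reflectionCoeff (n + 1) t =
        (-(t : ℂ) / 2) ^ (n + 1) / ((n + 1).factorial : ℂ)
          * (1 - 1 / (((n + 1 : ℕ) : ℂ) + 1) * ((t : ℂ) ^ 2 / 4) + E t) := by
  set a : ℝ := (-1 / 2) ^ (n + 1) / (n + 1).factorial with ha
  have ha0 : a ≠ 0 := by
    have : ((n + 1).factorial : ℝ) ≠ 0 := by positivity
    rw [ha]
    exact div_ne_zero (pow_ne_zero _ (by norm_num)) this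
  refine ⟨fun t => ((a⁻¹ * (t ^ (n + 1))⁻¹ * (verblunsky (n + 1) t - a * t ^ (n + 1)
      - -(a / (4 * (n + 2))) * t ^ (n + 3)) : ℝ) : ℂ), ?_, fun t ht => ?_⟩
  · rw [Complex.isBigO_ofReal_left]
    refine ((((isBigO_refl (fun t : ℝ => (t ^ (n + 1))⁻¹) _).const_mul_left a⁻¹).mul
      (verblunsky_expansion n)).congr' .rfl ?_)
    refine eventually_mem_nhdsWithin.mono fun t (ht : t ≠ 0) => ?_
    field_simp
    ring
  · have hpow : (-(t : ℂ) / 2) ^ (n + 1) / ((n + 1).factorial : ℂ)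
        = ((a * t ^ (n + 1) : ℝ) : ℂ) := by
      rw [ha, show -(t : ℂ) / 2 = (-1 / 2) * t by ring, mul_pow]
      push_cast
      ring
    rw [hpow, reflectionCoeff_eq_verblunsky]
    have key : verblunsky (n + 1) t = a * t ^ (n + 1) * (1 - 1 / (((n + 1 : ℕ) : ℝ) + 1)
        * (t ^ 2 / 4) + a⁻¹ * (t ^ (n + 1))⁻¹ * (verblunsky (n + 1) t - a * t ^ (n + 1)
      - -(a / (4 * (n + 2))) * t ^ (n + 3))) := by
      have : (n : ℝ) + 2 ≠ 0 := by positivity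
      rw [show (((n + 1 : ℕ) : ℝ) + 1) = n + 2 by push_cast; ring]
      field_simp
      ring
    have key' := congrArg (fun x : ℝ => (x : ℂ)) key
    push_cast at key' ⊢
    exact key'

theorem lemma2p4 (n : ℕ) (hn : 1 ≤ n) :
    -- the second order differential equation
    (∀ t : ℝ, t ≠ 0 →
      reflectionCoeff n t ≠ 1 ∧ reflectionCoeff n t ≠ -1 ∧
      DifferentiableAt ℝ (reflectionCoeff n) t ∧
      DifferentiableAt ℝ (deriv (reflectionCoeff n)) t ∧
      deriv (deriv (reflectionCoeff n)) t =
        1 / 2 * (1 / (reflectionCoeff n t + 1) + 1 / (reflectionCoeff n t - 1))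
            * deriv (reflectionCoeff n) t ^ 2
          - 1 / (t : ℂ) * deriv (reflectionCoeff n) t
          - reflectionCoeff n t * (1 - reflectionCoeff n t ^ 2)
          + (n : ℂ) ^ 2 / (t : ℂ) ^ 2
            * (reflectionCoeff n t / (1 - reflectionCoeff n t ^ 2))) ∧
    -- the expansion at `t = 0`, with a relative error `O(t ^ 4)`
    (∃ E : ℝ → ℂ, E =O[𝓝[≠] 0] (fun t : ℝ => t ^ 4) ∧
      ∀ t : ℝ, t ≠ 0 → reflectionCoeff n t =
        (-(t : ℂ) / 2) ^ n / (n.factorial : ℂ) * (1 - 1 / ((n : ℂ) + 1) * ((t : ℂ) ^ 2 / 4) + E t)) ∧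
    -- the substitution `r_n = (z_n + 1) / (z_n - 1)` defines `z_n`, which solves Painlevé V
    (∃ z : ℝ → ℂ, ∀ t : ℝ, t ≠ 0 →
      z t ≠ 1 ∧ reflectionCoeff n t = (z t + 1) / (z t - 1)) ∧
    (∀ z : ℝ → ℂ,
      (∀ t : ℝ, t ≠ 0 → z t ≠ 1 ∧ reflectionCoeff n t = (z t + 1) / (z t - 1)) →
      SolvesPainleveV ((n : ℂ) ^ 2 / 8) (-((n : ℂ) ^ 2 / 8)) 0 (-2) z {t : ℝ | t ≠ 0}) := by
  obtain ⟨m, rfl⟩ : ∃ m, n = m + 1 := ⟨n - 1, by omega⟩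
  have hne := fun t => reflectionCoeff_ne_one_and_ne_neg_one hn t
  refine ⟨fun t ht => ⟨(hne t).1, (hne t).2, (hasDerivAt_reflectionCoeff m ht).differentiableAt,
    (hasDerivAt_deriv_reflectionCoeff m ht).differentiableAt,
    (hasDerivAt_deriv_reflectionCoeff m ht).deriv⟩, reflectionCoeff_expansion m,
    ⟨fun t => (reflectionCoeff (m + 1) t + 1) / (reflectionCoeff (m + 1) t - 1), fun t _ => ?_⟩,
    fun z hz => solvesPainleveV_of_moebius (fun t _ => (hne t).1) (fun t _ => (hne t).2)
      (fun t ht => (hasDerivAt_reflectionCoeff m ht).differentiableAt)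
      (fun t ht => hasDerivAt_deriv_reflectionCoeff m ht) hz⟩
  have h := sub_ne_zero.2 (hne t).1
  have h1 : (reflectionCoeff (m + 1) t + 1) / (reflectionCoeff (m + 1) t - 1) - 1
      = 2 / (reflectionCoeff (m + 1) t - 1) := by
    field_simp
    ring
  refine ⟨sub_ne_zero.1 (by rw [h1]; exact div_ne_zero two_ne_zero h), ?_⟩
  rw [h1]
  field_simp
  ring
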